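/- Let $A_0,A_1,A_2$ be real symmetric $n\times n$ matrices, and suppose there is $x_0\in\mathbb{R}^n$ with $x_0^TA_1x_0<0$ and $x_0^TA_2x_0<0$. Say that Property $\mathcal{IR}$ holds for $A_0,A_1,A_2$ if there exist real numbers $\mu_1,\mu_2,\mu_3>0$ and vectors $x_1,x_2\in\mathbb{R}^n$ such that (IR.1) $Z:=A_0+\mu_1A_1+\mu_2A_2+\mu_3I_n\succeq0$ and the null space of $Z$ is the linear span of $x_1$ and $x_2$; (IR.2) $x_1^TA_1x_1=x_2^TA_1x_2=0$ and $x_1^TA_1x_2\neq0$; (IR.3) $x_1^TA_2x_1<0<x_2^TA_2x_2$. Then the following two statements are equivalent: (i) the system $x^TA_0x<0,\ x^TA_1x\le0,\ x^TA_2x\le0$ has no solution $x\in\mathbb{R}^n$, and Property $\mathcal{IR}$ fails for $A_0,A_1,A_2$; (ii) there exist $\mu_1^0\ge0$ and $\mu_2^0\ge0$ such that $A_0+\mu_1^0A_1+\mu_2^0A_2\succeq0$. Here $\succeq0$ means positive semidefinite. -/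

import Mathlib

open scoped Matrix

/-- Property `IR` for three real `n × n` matrices `A₀, A₁, A₂`: there are positive reals
`μ₁, μ₂, μ₃` and vectors `x₁, x₂` such that
* `Z = A₀ + μ₁ A₁ + μ₂ A₂ + μ₃ I` is positive semidefinite and its null space is the linear span
  of `x₁` and `x₂`;
* `x₁ᵀ A₁ x₁ = x₂ᵀ A₁ x₂ = 0` and `x₁ᵀ A₁ x₂ ≠ 0`;
* `x₁ᵀ A₂ x₁ < 0 < x₂ᵀ A₂ x₂`. -/
def PropertyIR {n : ℕ} (A₀ A₁ A₂ : Matrix (Fin n) (Fin n) ℝ) : Prop :=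
  ∃ (μ₁ μ₂ μ₃ : ℝ) (x₁ x₂ : Fin n → ℝ),
    0 < μ₁ ∧ 0 < μ₂ ∧ 0 < μ₃ ∧
    (A₀ + μ₁ • A₁ + μ₂ • A₂ + μ₃ • (1 : Matrix (Fin n) (Fin n) ℝ)).PosSemidef ∧
    Submodule.span ℝ {x₁, x₂} =
      LinearMap.ker
        (A₀ + μ₁ • A₁ + μ₂ • A₂ + μ₃ • (1 : Matrix (Fin n) (Fin n) ℝ)).mulVecLin ∧
    x₁ ⬝ᵥ A₁ *ᵥ x₁ = 0 ∧ x₂ ⬝ᵥ A₁ *ᵥ x₂ = 0 ∧ x₁ ⬝ᵥ A₁ *ᵥ x₂ ≠ 0 ∧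
    x₁ ⬝ᵥ A₂ *ᵥ x₁ < 0 ∧ 0 < x₂ ⬝ᵥ A₂ *ᵥ x₂

/-!
A quadratic S-lemma with two homogeneous constraints, where strong duality fails exactly under
`PropertyIR`.

Minimize the shift `c ≥ 0` for which `Z = A₀ + a A₁ + b A₂ + c I` is positive semidefinite with some
multipliers `a, b ≥ 0`. The Slater point makes the feasible set compact, so the minimum is attained
(`exists_minimal_shift`); if it is zero, the required multipliers are found. Otherwise let
`N = ker Z`. No combination `d A₁ + e A₂`, with `d, e` admissible for the signs of the multipliers,
is positive definite on `N`, because moving in that direction would decrease `c`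
(`not_pos_combination_of_minimal`). Separation in the plane (`exists_pair_or_pos_combination`) then
gives `x, y ∈ N`, `x ≠ 0`, such that the sum of the values of `(A₁, A₂)` at `x` and `y` is
nonpositive and complementary to the multipliers.

It remains to replace the pair by one vector, which then solves the quadratic system because
`xᵀ A₀ x = -c xᵀ x` for complementary `x ∈ N` (`qf_neg_of_complementary`). The tool is a rotation of
the pair found by the intermediate value theorem (`exists_isotropic_pair`). If the sum of the values
is nonzero this is Dines' convexity theorem (`exists_qf_eq_add`). If it is zero, the rotation gives
`A₁`-isotropic vectors `u, v` at which `A₂` takes opposite values. If a multiplier vanishes, one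
member of a suitable pair is a solution. If both are positive, then either a common zero of the two
forms in `N` is a solution, or `N` is the plane spanned by `u` and `v` and `PropertyIR` holds: with a
further dimension, `u` and `v` are joined by `A₁`-isotropic vectors, and `A₂` vanishes on the way
(`exists_common_zero_or_hyperbolic_plane`).

Conversely, under `PropertyIR` a positive semidefinite `A₀ + a A₁ + b A₂` would exceed `Z` on `N` by a
positive definite form, which at the two isotropic vectors forces opposite signs of the change in
the second multiplier (`not_propertyIR_of_nonneg`).
-/

/-! ### Values of quadratic forms -/

/-- The quadratic form `x ↦ xᵀ A x` of a square matrix, which need not be symmetric. -/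
def qf {n : ℕ} (A : Matrix (Fin n) (Fin n) ℝ) (x : Fin n → ℝ) : ℝ := x ⬝ᵥ A *ᵥ x

section QuadraticForms

variable {n : ℕ} (A B : Matrix (Fin n) (Fin n) ℝ) (x y : Fin n → ℝ)

lemma qf_add_matrix : qf (A + B) x = qf A x + qf B x := by
  simp [qf, Matrix.add_mulVec]

lemma qf_smul_matrix (c : ℝ) : qf (c • A) x = c * qf A x := by
  simp [qf, Matrix.smul_mulVec]

lemma qf_one : qf 1 x = x ⬝ᵥ x := by
  simp [qf]

lemma qf_zero : qf A 0 = 0 := by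
  simp [qf]

lemma qf_smul (c : ℝ) : qf A (c • x) = c ^ 2 * qf A x := by
  simp only [qf, Matrix.mulVec_smul, smul_dotProduct, dotProduct_smul, smul_eq_mul]
  ring

lemma qf_combo (s t : ℝ) :
    qf A (s • x + t • y)
      = s ^ 2 * qf A x + s * t * (x ⬝ᵥ A *ᵥ y + y ⬝ᵥ A *ᵥ x) + t ^ 2 * qf A y := by
  simp only [qf, Matrix.mulVec_add, Matrix.mulVec_smul, add_dotProduct, dotProduct_add,
    smul_dotProduct, dotProduct_smul, smul_eq_mul]
  ring

lemma continuous_qf : Continuous (qf A) := by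
  unfold qf
  fun_prop

variable {x} in
lemma qf_one_pos (hx : x ≠ 0) : 0 < qf 1 x := by
  rw [qf_one]
  have h : 0 ≤ x ⬝ᵥ x := Finset.sum_nonneg fun i _ => mul_self_nonneg (x i)
  exact lt_of_le_of_ne h fun h' => hx (dotProduct_self_eq_zero.1 h'.symm)

lemma qf_one_nonneg : 0 ≤ qf 1 x := by
  rw [qf_one]
  exact Finset.sum_nonneg fun i _ => mul_self_nonneg (x i)

variable {A} in
lemma dotProduct_mulVec_comm_of_isSymm (hA : A.IsSymm) : x ⬝ᵥ A *ᵥ y = y ⬝ᵥ A *ᵥ x := by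
  rw [Matrix.dotProduct_mulVec, ← Matrix.mulVec_transpose, hA.eq, dotProduct_comm]

variable {A} in
lemma posSemidef_iff_qf_nonneg (hA : A.IsSymm) : A.PosSemidef ↔ ∀ x, 0 ≤ qf A x := by
  rw [Matrix.posSemidef_iff_dotProduct_mulVec]
  simp only [star_trivial, qf]
  refine and_iff_right ?_
  rw [Matrix.IsHermitian, Matrix.conjTranspose_eq_transpose_of_trivial, hA.eq]

variable {A x} in
lemma mulVec_eq_zero_iff_qf (hA : A.PosSemidef) : A *ᵥ x = 0 ↔ qf A x = 0 := by
  rw [← hA.dotProduct_mulVec_zero_iff, star_trivial, qf]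

variable {A x y} in
/-- If the values of the form at `x` and `y` cancel, a rotation in the plane of coordinates along
`x` and `y` makes both vectors isotropic. Rotations preserve `x xᵀ + y yᵀ`, hence the sum of the
values of every quadratic form. -/
lemma exists_isotropic_pair (N : Submodule ℝ (Fin n → ℝ)) (hx : x ∈ N) (hy : y ∈ N)
    (h : qf A x + qf A y = 0) :
    ∃ u ∈ N, ∃ v ∈ N, qf A u = 0 ∧ qf A v = 0 ∧ ∀ B, qf B u + qf B v = qf B x + qf B y := by
  have hcont : ContinuousOn (fun θ : ℝ => qf A (Real.cos θ • x + Real.sin θ • y))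
      (Set.uIcc 0 (Real.pi / 2)) := by
    refine ((continuous_qf A).comp ?_).continuousOn
    fun_prop
  have hmem : (0 : ℝ) ∈ Set.uIcc (qf A (Real.cos 0 • x + Real.sin 0 • y))
      (qf A (Real.cos (Real.pi / 2) • x + Real.sin (Real.pi / 2) • y)) := by
    simp only [Real.cos_zero, Real.sin_zero, Real.cos_pi_div_two, Real.sin_pi_div_two, one_smul,
      zero_smul, add_zero, zero_add, Set.mem_uIcc]
    rcases le_total (qf A x) 0 with h' | h'
    · exact Or.inl ⟨h', by linarith⟩
    · exact Or.inr ⟨by linarith, h'⟩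
  obtain ⟨θ, -, hθ⟩ := intermediate_value_uIcc hcont hmem
  have hsum : ∀ B, qf B (Real.cos θ • x + Real.sin θ • y)
      + qf B ((-Real.sin θ) • x + Real.cos θ • y) = qf B x + qf B y := by
    intro B
    rw [qf_combo, qf_combo]
    linear_combination (qf B x + qf B y) * Real.sin_sq_add_cos_sq θ
  refine ⟨_, N.add_mem (N.smul_mem _ hx) (N.smul_mem _ hy), _,
    N.add_mem (N.smul_mem _ hx) (N.smul_mem _ hy), hθ, ?_, hsum⟩
  have := hsum A
  simp only at hθ
  linarith

end QuadraticForms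

/-! ### The joint range of two quadratic forms -/

section JointRange

variable {n : ℕ} {A₁ A₂ : Matrix (Fin n) (Fin n) ℝ} {N : Submodule ℝ (Fin n → ℝ)}
  {x y : Fin n → ℝ}

/-- Dines' theorem for nonzero sums: the joint range of two quadratic forms on a subspace contains
the sum of any two of its elements. -/
lemma exists_qf_eq_add (hx : x ∈ N) (hy : y ∈ N)
    (h : qf A₁ x + qf A₁ y ≠ 0 ∨ qf A₂ x + qf A₂ y ≠ 0) :
    ∃ z ∈ N, z ≠ 0 ∧ qf A₁ z = qf A₁ x + qf A₁ y ∧ qf A₂ z = qf A₂ x + qf A₂ y := by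
  obtain ⟨a, ha⟩ : ∃ a, a = qf A₁ x + qf A₁ y := ⟨_, rfl⟩
  obtain ⟨b, hb⟩ : ∃ b, b = qf A₂ x + qf A₂ y := ⟨_, rfl⟩
  rw [← ha, ← hb] at h ⊢
  have hab : 0 < a ^ 2 + b ^ 2 := by
    rcases h with h | h <;> positivity
  -- A form vanishing in the direction `(a, b)`: isotropic vectors have values proportional to it.
  obtain ⟨u, hu, v, hv, hu0, hv0, hsum⟩ := exists_isotropic_pair (A := b • A₁ + (-a) • A₂) N hx hy
    (by simp only [qf_add_matrix, qf_smul_matrix, ha, hb]; ring)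
  simp only [qf_add_matrix, qf_smul_matrix] at hu0 hv0
  have key : ∀ u ∈ N, b * qf A₁ u + -a * qf A₂ u = 0 → 0 < a * qf A₁ u + b * qf A₂ u →
      ∃ z ∈ N, z ≠ 0 ∧ qf A₁ z = a ∧ qf A₂ z = b := by
    intro u hu h0 hpos
    have hr : 0 ≤ (a ^ 2 + b ^ 2) / (a * qf A₁ u + b * qf A₂ u) := by positivity
    have h1 : qf A₁ (Real.sqrt ((a ^ 2 + b ^ 2) / (a * qf A₁ u + b * qf A₂ u)) • u) = a := by
      rw [qf_smul, Real.sq_sqrt hr]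
      field_simp
      linear_combination b * h0
    have h2 : qf A₂ (Real.sqrt ((a ^ 2 + b ^ 2) / (a * qf A₁ u + b * qf A₂ u)) • u) = b := by
      rw [qf_smul, Real.sq_sqrt hr]
      field_simp
      linear_combination (-a) * h0
    refine ⟨_, N.smul_mem _ hu, ?_, h1, h2⟩
    intro hz
    rw [hz, qf_zero] at h1 h2
    rw [← h1, ← h2] at hab
    norm_num at hab
  have h12 : 0 < (a * qf A₁ u + b * qf A₂ u) + (a * qf A₁ v + b * qf A₂ v) := by
    have h1 := hsum A₁
    have h2 := hsum A₂
    rw [← ha] at h1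
    rw [← hb] at h2
    have : (a * qf A₁ u + b * qf A₂ u) + (a * qf A₁ v + b * qf A₂ v) = a ^ 2 + b ^ 2 := by
      linear_combination a * h1 + b * h2
    rwa [this]
  rcases le_or_gt (a * qf A₁ u + b * qf A₂ u) 0 with h' | h'
  · exact key v hv hv0 (by linarith)
  · exact key u hu hu0 h'

lemma exists_qf_eq_add' (hx : x ∈ N) (hy : y ∈ N) :
    ∃ z ∈ N, qf A₁ z = qf A₁ x + qf A₁ y ∧ qf A₂ z = qf A₂ x + qf A₂ y := by
  by_cases h : qf A₁ x + qf A₁ y ≠ 0 ∨ qf A₂ x + qf A₂ y ≠ 0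
  · obtain ⟨z, hz, -, h⟩ := exists_qf_eq_add hx hy h
    exact ⟨z, hz, h⟩
  · push Not at h
    exact ⟨0, N.zero_mem, by rw [qf_zero, h.1], by rw [qf_zero, h.2]⟩

/-- If the values of both forms cancel at `x` and `y`, a rotated pair is isotropic for the first
form, and the second form is nonpositive at one of its members. -/
lemma exists_isotropic_nonpos (hx : x ∈ N) (hy : y ∈ N) (hx0 : x ≠ 0)
    (h1 : qf A₁ x + qf A₁ y = 0) (h2 : qf A₂ x + qf A₂ y = 0) :
    ∃ z ∈ N, z ≠ 0 ∧ qf A₁ z = 0 ∧ qf A₂ z ≤ 0 := by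
  obtain ⟨u, hu, v, hv, hu0, hv0, hsum⟩ := exists_isotropic_pair N hx hy h1
  have hne : u ≠ 0 ∨ v ≠ 0 := by
    by_contra! h
    have := hsum 1
    rw [h.1, h.2, qf_zero] at this
    linarith [qf_one_pos hx0, qf_one_nonneg y]
  have h2' := hsum A₂
  rw [h2] at h2'
  by_cases hu' : u = 0
  · rw [hu', qf_zero] at h2'
    exact ⟨v, hv, hne.resolve_left (not_not.2 hu'), hv0, by linarith⟩
  by_cases hv' : v = 0
  · rw [hv', qf_zero] at h2'
    exact ⟨u, hu, hu', hu0, by linarith⟩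
  rcases le_total (qf A₂ u) 0 with h | h
  · exact ⟨u, hu, hu', hu0, h⟩
  · exact ⟨v, hv, hv', hv0, by linarith⟩

/-- Along a continuous path of `A₁`-isotropic vectors from `A₂ ≤ 0` to `A₂ ≥ 0` both forms
vanish somewhere; it suffices that the path avoids zero where `A₂` vanishes. -/
lemma exists_common_zero_of_path (γ : ℝ → Fin n → ℝ) (hγ : Continuous γ) (hN : ∀ t, γ t ∈ N)
    (h1 : ∀ t, qf A₁ (γ t) = 0) (hne : ∀ t, qf A₂ (γ t) = 0 → γ t ≠ 0)
    (h20 : qf A₂ (γ 0) ≤ 0) (h21 : 0 ≤ qf A₂ (γ 1)) :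
    ∃ z ∈ N, z ≠ 0 ∧ qf A₁ z = 0 ∧ qf A₂ z = 0 := by
  obtain ⟨t, -, ht⟩ := intermediate_value_Icc zero_le_one
    (((continuous_qf A₂).comp hγ).continuousOn (s := Set.Icc 0 1)) ⟨h20, h21⟩
  exact ⟨γ t, hN t, hne t ht, h1 t, ht⟩

/-- In dimension at least three the cone of `A₁`-isotropic vectors is connected up to sign: two
isotropic vectors `u`, `v` spanning a hyperbolic plane are joined by a path which leaves the plane
along some `y`. If `A₂` takes opposite signs at `u` and `v`, the forms have a common zero. -/
lemma exists_common_zero_of_notMem_span {u v : Fin n → ℝ} (hA₁ : A₁.IsSymm) (hu : u ∈ N)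
    (hv : v ∈ N) (hu1 : qf A₁ u = 0) (hv1 : qf A₁ v = 0) (huv : u ⬝ᵥ A₁ *ᵥ v ≠ 0)
    (hu2 : qf A₂ u < 0) (hv2 : 0 < qf A₂ v) (hy : y ∈ N)
    (hyS : y ∉ Submodule.span ℝ {u, v}) :
    ∃ z ∈ N, z ≠ 0 ∧ qf A₁ z = 0 ∧ qf A₂ z = 0 := by
  -- Replace `y` by its component `A₁`-orthogonal to `u` and `v`.
  obtain ⟨w, hw, hwS, hwu, hwv⟩ : ∃ w ∈ N, w ∉ Submodule.span ℝ {u, v} ∧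
      u ⬝ᵥ A₁ *ᵥ w = 0 ∧ v ⬝ᵥ A₁ *ᵥ w = 0 := by
    refine ⟨y - ((v ⬝ᵥ A₁ *ᵥ y / (u ⬝ᵥ A₁ *ᵥ v)) • u + (u ⬝ᵥ A₁ *ᵥ y / (u ⬝ᵥ A₁ *ᵥ v)) • v),
      N.sub_mem hy (N.add_mem (N.smul_mem _ hu) (N.smul_mem _ hv)), ?_, ?_, ?_⟩
    · intro h
      apply hyS
      have := Submodule.add_mem _ h
        (Submodule.mem_span_pair.2 ⟨v ⬝ᵥ A₁ *ᵥ y / (u ⬝ᵥ A₁ *ᵥ v),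
          u ⬝ᵥ A₁ *ᵥ y / (u ⬝ᵥ A₁ *ᵥ v), rfl⟩)
      simpa using this
    · rw [Matrix.mulVec_sub, Matrix.mulVec_add, Matrix.mulVec_smul, Matrix.mulVec_smul,
        dotProduct_sub, dotProduct_add, dotProduct_smul, dotProduct_smul, smul_eq_mul, smul_eq_mul,
        div_mul_cancel₀ _ huv, show u ⬝ᵥ A₁ *ᵥ u = 0 from hu1]
      ring
    · rw [Matrix.mulVec_sub, Matrix.mulVec_add, Matrix.mulVec_smul, Matrix.mulVec_smul,
        dotProduct_sub, dotProduct_add, dotProduct_smul, dotProduct_smul, smul_eq_mul, smul_eq_mul,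
        dotProduct_mulVec_comm_of_isSymm v u hA₁, div_mul_cancel₀ _ huv,
        show v ⬝ᵥ A₁ *ᵥ v = 0 from hv1]
      ring
  have hwu' := dotProduct_mulVec_comm_of_isSymm w u hA₁
  have hwv' := dotProduct_mulVec_comm_of_isSymm w v hA₁
  by_cases hq : qf A₁ w = 0
  · -- `w` is radical: go straight from `u` to `w`, or from `w` to `v`.
    have hu0 : u ≠ 0 := by
      rintro rfl
      rw [qf_zero] at hu2
      exact hu2.false
    have hv0 : v ≠ 0 := by
      rintro rfl
      rw [qf_zero] at hv2
      exact hv2.false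
    rcases le_total 0 (qf A₂ w) with h | h
    · refine exists_common_zero_of_path (fun t => (1 - t) • u + t • w) (by fun_prop)
        (fun t => N.add_mem (N.smul_mem _ hu) (N.smul_mem _ hw)) (fun t => ?_) (fun t _ hz => ?_)
        (by simpa using hu2.le) (by simpa using h)
      · rw [qf_combo, hu1, hq, hwu', hwu]
        ring
      · by_cases ht : t = 0
        · exact hu0 (by simpa [ht] using hz)
        · refine hwS (Submodule.mem_span_pair.2 ⟨-(1 - t) / t, 0, ?_⟩)
          have : w = t⁻¹ • (t • w) := by rw [smul_smul, inv_mul_cancel₀ ht, one_smul]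
          rw [this, eq_neg_of_add_eq_zero_right hz, zero_smul, add_zero, ← neg_smul, smul_smul]
          congr 1
          ring
    · refine exists_common_zero_of_path (fun t => (1 - t) • w + t • v) (by fun_prop)
        (fun t => N.add_mem (N.smul_mem _ hw) (N.smul_mem _ hv)) (fun t => ?_) (fun t _ hz => ?_)
        (by simpa using h) (by simpa using hv2.le)
      · rw [qf_combo, hv1, hq, hwv', hwv]
        ring
      · by_cases ht : 1 - t = 0
        · exact hv0 (by simpa [ht, show t = 1 by linarith] using hz)
        · refine hwS (Submodule.mem_span_pair.2 ⟨0, -t / (1 - t), ?_⟩)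
          have : w = (1 - t)⁻¹ • ((1 - t) • w) := by rw [smul_smul, inv_mul_cancel₀ ht, one_smul]
          rw [this, eq_neg_of_add_eq_zero_left hz, zero_smul, zero_add, ← neg_smul, smul_smul]
          congr 1
          ring
  · -- The path `(1 - t)² u + ε t² v + t (1 - t) k w` is isotropic if `k² A₁(w) = -2 ε uᵀ A₁ v`;
    -- the sign `ε` makes `k` real.
    obtain ⟨ε, hε, hεpos⟩ : ∃ ε : ℝ, ε ^ 2 = 1 ∧
        0 < -2 * ε * (u ⬝ᵥ A₁ *ᵥ v) / qf A₁ w := by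
      have h0 : (u ⬝ᵥ A₁ *ᵥ v) / qf A₁ w ≠ 0 := div_ne_zero huv hq
      rcases lt_or_gt_of_ne h0 with h | h
      · exact ⟨1, by norm_num, by rw [mul_div_assoc]; linarith⟩
      · exact ⟨-1, by norm_num, by rw [mul_div_assoc]; linarith⟩
    obtain ⟨k, hk⟩ : ∃ k, k = Real.sqrt (-2 * ε * (u ⬝ᵥ A₁ *ᵥ v) / qf A₁ w) := ⟨_, rfl⟩
    have hk0 : k ≠ 0 := by
      rw [hk]
      exact (Real.sqrt_pos.2 hεpos).ne'
    have hkq : k ^ 2 * qf A₁ w = -2 * ε * (u ⬝ᵥ A₁ *ᵥ v) := by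
      rw [hk, Real.sq_sqrt hεpos.le, div_mul_cancel₀ _ hq]
    have hvu := dotProduct_mulVec_comm_of_isSymm v u hA₁
    refine exists_common_zero_of_path
      (fun t => (1 : ℝ) • ((1 - t) ^ 2 • u + (ε * t ^ 2) • v) + (t * (1 - t) * k) • w)
      (by fun_prop)
      (fun t => N.add_mem (N.smul_mem _ (N.add_mem (N.smul_mem _ hu) (N.smul_mem _ hv)))
        (N.smul_mem _ hw)) (fun t => ?_) (fun t ht hz => ?_) ?_ ?_
    · rw [qf_combo, qf_combo, hu1, hv1, hvu]
      simp only [Matrix.mulVec_add, Matrix.mulVec_smul, add_dotProduct, dotProduct_add,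
        smul_dotProduct, dotProduct_smul, smul_eq_mul, hwu', hwv', hwu, hwv]
      linear_combination (t ^ 2 * (1 - t) ^ 2) * hkq
    · by_cases htk : t * (1 - t) * k = 0
      · rcases mul_eq_zero.1 ((mul_eq_zero.1 htk).resolve_right hk0) with h | h
        · rw [h] at ht
          simp only [one_smul, sub_zero, one_pow, mul_zero, zero_smul, zero_mul, add_zero, ne_eq,
            OfNat.ofNat_ne_zero, not_false_eq_true, zero_pow] at ht
          exact hu2.ne ht
        · rw [show t = 1 by linarith] at ht
          simp only [one_smul, sub_self, one_pow, mul_one, zero_smul, zero_mul, mul_zero, add_zero,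
            zero_add, ne_eq, OfNat.ofNat_ne_zero, not_false_eq_true, zero_pow, qf_smul, hε,
            one_mul] at ht
          exact hv2.ne' ht
      · refine hwS ?_
        have hmem : (t * (1 - t) * k) • w ∈ Submodule.span ℝ {u, v} := by
          rw [eq_neg_of_add_eq_zero_right hz, one_smul]
          exact Submodule.neg_mem _ (Submodule.mem_span_pair.2 ⟨_, _, rfl⟩)
        exact (Submodule.smul_mem_iff _ htk).1 hmem
    · simpa using hu2.le
    · simpa [qf_smul, hε] using hv2.le

/-- If two quadratic forms cancel at a pair of vectors of `N`, they have a common nontrivial zero in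
`N` unless `N` is a hyperbolic plane for the first form and the second form takes opposite signs on
its two isotropic lines. -/
lemma exists_common_zero_or_hyperbolic_plane (hA₁ : A₁.IsSymm) (hx : x ∈ N) (hy : y ∈ N)
    (hx0 : x ≠ 0) (h1 : qf A₁ x + qf A₁ y = 0) (h2 : qf A₂ x + qf A₂ y = 0) :
    (∃ z ∈ N, z ≠ 0 ∧ qf A₁ z = 0 ∧ qf A₂ z = 0) ∨
    ∃ u v, Submodule.span ℝ {u, v} = N ∧ qf A₁ u = 0 ∧ qf A₁ v = 0 ∧ u ⬝ᵥ A₁ *ᵥ v ≠ 0 ∧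
      qf A₂ u < 0 ∧ 0 < qf A₂ v := by
  refine or_iff_not_imp_left.2 fun hno => ?_
  have key : ∀ u ∈ N, ∀ v ∈ N, qf A₁ u = 0 → qf A₁ v = 0 → qf A₂ u + qf A₂ v = 0 →
      qf A₂ u < 0 → ∃ u v, Submodule.span ℝ {u, v} = N ∧ qf A₁ u = 0 ∧ qf A₁ v = 0 ∧
        u ⬝ᵥ A₁ *ᵥ v ≠ 0 ∧ qf A₂ u < 0 ∧ 0 < qf A₂ v := by
    intro u hu v hv hu1 hv1 hsum hu2
    have huv : u ⬝ᵥ A₁ *ᵥ v ≠ 0 := by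
      -- Otherwise `A₁` vanishes on the span of `u` and `v`, where `A₂` has an isotropic vector.
      intro huv
      have hvu := dotProduct_mulVec_comm_of_isSymm v u hA₁
      have hS : Submodule.span ℝ {u, v} ≤ N := by
        rw [Submodule.span_le]
        rintro _ (rfl | rfl) <;> assumption
      have hu0 : u ≠ 0 := by
        rintro rfl
        rw [qf_zero] at hu2
        exact hu2.false
      obtain ⟨z, hz, hz0, hz2, -⟩ := exists_isotropic_nonpos (A₁ := A₂) (A₂ := A₁)
        (N := Submodule.span ℝ {u, v}) (Submodule.subset_span (by simp))
        (Submodule.subset_span (by simp)) hu0 hsum (by rw [hu1, hv1, add_zero])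
      obtain ⟨a, b, rfl⟩ := Submodule.mem_span_pair.1 hz
      exact hno ⟨_, hS hz, hz0, by rw [qf_combo, hu1, hv1, hvu, huv]; ring, hz2⟩
    refine ⟨u, v, le_antisymm ?_ fun y hy => ?_, hu1, hv1, huv, hu2, by linarith⟩
    · rw [Submodule.span_le]
      rintro _ (rfl | rfl) <;> assumption
    · by_contra hyS
      exact hno (exists_common_zero_of_notMem_span hA₁ hu hv hu1 hv1 huv hu2 (by linarith) hy hyS)
  obtain ⟨u, hu, v, hv, hu1, hv1, hsum⟩ := exists_isotropic_pair N hx hy h1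
  have h2' := hsum A₂
  rw [h2] at h2'
  rcases lt_trichotomy (qf A₂ u) 0 with h | h | h
  · exact key u hu v hv hu1 hv1 h2' h
  · refine absurd ?_ hno
    by_cases hu0 : u = 0
    · refine ⟨v, hv, ?_, hv1, by linarith⟩
      rintro rfl
      have := hsum 1
      rw [hu0, qf_zero] at this
      linarith [qf_one_pos hx0, qf_one_nonneg y]
    · exact ⟨u, hu, hu0, hu1, h⟩
  · exact key v hv u hu hv1 hu1 (by linarith) (by linarith)

end JointRange

/-! ### Compactness and perturbation -/

/-- Carathéodory's theorem exhibits the convex hull of a compact set as the image of a product of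
compact sets. -/
lemma IsCompact.convexHull_of_finiteDimensional {E : Type*} [NormedAddCommGroup E]
    [NormedSpace ℝ E] [FiniteDimensional ℝ E] {s : Set E} (hs : IsCompact s) :
    IsCompact (convexHull ℝ s) := by
  have himage : convexHull ℝ s =
      (fun p : (Fin (Module.finrank ℝ E + 1) → ℝ) × (Fin (Module.finrank ℝ E + 1) → E) =>
        ∑ i, p.1 i • p.2 i) '' (stdSimplex ℝ (Fin (Module.finrank ℝ E + 1)) ×ˢ
          Set.univ.pi fun _ => s) := by
    apply subset_antisymm
    · intro x hx
      obtain ⟨ι, _, z, w, hz, haff, hw, hsum, hwx⟩ := eq_pos_convex_span_of_mem_convexHull hx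
      have hcard : Fintype.card ι ≤ Fintype.card (Fin (Module.finrank ℝ E + 1)) := by
        rw [Fintype.card_fin]
        exact haff.card_le_finrank_succ.trans (Nat.succ_le_succ (Submodule.finrank_le _))
      obtain ⟨e⟩ := Function.Embedding.nonempty_of_card_le hcard
      obtain ⟨i₀⟩ : Nonempty ι := by
        by_contra h
        rw [not_nonempty_iff] at h
        simp at hsum
      refine ⟨(Function.extend e w 0, Function.extend e z fun _ => z i₀), ⟨⟨?_, ?_⟩, ?_⟩, ?_⟩
      · intro j
        by_cases hj : ∃ i, e i = j
        · obtain ⟨i, rfl⟩ := hj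
          simpa only [e.injective.extend_apply] using (hw i).le
        · simp only [Function.extend_apply' _ _ _ hj, Pi.zero_apply, le_refl]
      · rw [← hsum]
        refine (Fintype.sum_of_injective e e.injective _ _ (fun j hj => ?_) fun i => ?_).symm
        · simp only [Function.extend_apply' _ _ _ hj, Pi.zero_apply]
        · simp only [e.injective.extend_apply]
      · intro j _
        by_cases hj : ∃ i, e i = j
        · obtain ⟨i, rfl⟩ := hj
          simpa only [e.injective.extend_apply] using hz ⟨i, rfl⟩
        · simpa only [Function.extend_apply' _ _ _ hj] using hz ⟨i₀, rfl⟩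
      · rw [← hwx]
        refine (Fintype.sum_of_injective e e.injective _ _ (fun j hj => ?_) fun i => ?_).symm
        · simp only [Function.extend_apply' _ _ _ hj, Pi.zero_apply, zero_smul]
        · simp only [e.injective.extend_apply]
    · rintro _ ⟨⟨w, z⟩, ⟨hw, hz⟩, rfl⟩
      exact (convex_convexHull ℝ s).sum_mem (fun i _ => hw.1 i) hw.2
        fun i _ => subset_convexHull ℝ s (hz i trivial)
  rw [himage]
  exact ((isCompact_stdSimplex ℝ _).prod (isCompact_univ_pi fun _ => hs)).image (by fun_prop)

section Perturbation

variable {n : ℕ}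

lemma isCompact_setOf_qf_one_eq_one : IsCompact {x : Fin n → ℝ | qf 1 x = 1} := by
  refine (isCompact_univ_pi fun _ => isCompact_Icc (a := (-1 : ℝ)) (b := 1)).of_isClosed_subset
    (isClosed_eq (continuous_qf 1) continuous_const) fun x hx i _ => ?_
  have h : x i * x i ≤ ∑ j, x j * x j :=
    Finset.single_le_sum (f := fun j => x j * x j) (fun j _ => mul_self_nonneg _)
      (Finset.mem_univ i)
  rw [Set.mem_ofPred_eq, qf_one] at hx
  rw [dotProduct] at hx
  exact abs_le.1 (abs_le_one_iff_mul_self_le_one.2 (hx ▸ h))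

lemma exists_smul_qf_one_eq_one {x : Fin n → ℝ} (hx : x ≠ 0) :
    ∃ r : ℝ, 0 < r ∧ qf 1 (r • x) = 1 := by
  have h := qf_one_pos hx
  refine ⟨Real.sqrt (qf 1 x)⁻¹, Real.sqrt_pos.2 (inv_pos.2 h), ?_⟩
  rw [qf_smul, Real.sq_sqrt (inv_pos.2 h).le, inv_mul_cancel₀ h.ne']

/-- A form which is positive on the unit sphere dominates a multiple of `xᵀ x`. -/
lemma exists_mul_qf_one_le {A : Matrix (Fin n) (Fin n) ℝ} (h : ∀ x, qf 1 x = 1 → 0 < qf A x) :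
    ∃ δ > 0, ∀ x, δ * qf 1 x ≤ qf A x := by
  obtain ⟨δ, hδ, hle⟩ := isCompact_setOf_qf_one_eq_one.exists_forall_le'
    (continuous_qf A).continuousOn h
  refine ⟨δ, hδ, fun x => ?_⟩
  by_cases hx : x = 0
  · rw [hx, qf_zero, qf_zero, mul_zero]
  · obtain ⟨r, hr, hr1⟩ := exists_smul_qf_one_eq_one hx
    have := hle _ hr1
    rw [qf_smul] at this hr1
    have hr2 : 0 < r ^ 2 := by positivity
    refine le_of_mul_le_mul_left ?_ hr2
    linear_combination this + δ * hr1

lemma exists_le_mul_qf_one (A : Matrix (Fin n) (Fin n) ℝ) :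
    ∃ M > 0, ∀ x, -M * qf 1 x ≤ qf A x := by
  obtain ⟨m, hm⟩ := (isCompact_setOf_qf_one_eq_one (n := n)).bddBelow_image
    (continuous_qf A).continuousOn
  obtain ⟨δ, hδ, h⟩ := exists_mul_qf_one_le (A := A + (|m| + 1) • 1) fun x hx => by
    rw [qf_add_matrix, qf_smul_matrix, hx]
    linarith [hm ⟨x, hx, rfl⟩, neg_abs_le m]
  refine ⟨|m| + 1, by positivity, fun x => ?_⟩
  have := h x
  rw [qf_add_matrix, qf_smul_matrix] at this
  linarith [mul_nonneg hδ.le (qf_one_nonneg x)]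

/-- Moving a positive semidefinite matrix slightly in a direction that is positive definite on its
null space makes it positive definite. -/
lemma exists_perturbation_pos {Z D : Matrix (Fin n) (Fin n) ℝ} (hZ : Z.PosSemidef)
    (hD : ∀ x, Z *ᵥ x = 0 → x ≠ 0 → 0 < qf D x) :
    ∃ ε₀ : ℝ, 0 < ε₀ ∧ ∀ ε, 0 < ε → ε < ε₀ → ∃ δ > 0, ∀ x, δ * qf 1 x ≤ qf (Z + ε • D) x := by
  have hZ0 : ∀ x, 0 ≤ qf Z x := fun x => by simpa [qf] using hZ.dotProduct_mulVec_nonneg x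
  -- `Z` is bounded below on the part of the sphere where `D` is nonpositive.
  obtain ⟨m, hm, hle⟩ : ∃ m > 0, ∀ x ∈ {x : Fin n → ℝ | qf 1 x = 1} ∩ {x | qf D x ≤ 0},
      m ≤ qf Z x := by
    refine (isCompact_setOf_qf_one_eq_one.inter_right
      (isClosed_le (continuous_qf D) continuous_const)).exists_forall_le'
      (continuous_qf Z).continuousOn fun x hx => ?_
    refine lt_of_le_of_ne (hZ0 x) fun h => ?_
    refine (hD x ((mulVec_eq_zero_iff_qf hZ).2 h.symm) ?_).not_ge hx.2
    rintro rfl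
    have := hx.1
    rw [Set.mem_ofPred_eq, qf_zero] at this
    exact zero_ne_one this
  obtain ⟨M, hM, hMD⟩ := exists_le_mul_qf_one D
  refine ⟨m / M, by positivity, fun ε hε hεm => exists_mul_qf_one_le fun x hx => ?_⟩
  rw [qf_add_matrix, qf_smul_matrix]
  rcases le_or_gt (qf D x) 0 with h | h
  · have h1 := hle x ⟨hx, h⟩
    have h2 := mul_le_mul_of_nonneg_left (hMD x) hε.le
    rw [hx] at h2
    rw [lt_div_iff₀ hM] at hεm
    linarith
  · linarith [hZ0 x, mul_pos hε h]

end Perturbation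

/-! ### Duality -/

section Duality

variable {n : ℕ} {A₀ A₁ A₂ : Matrix (Fin n) (Fin n) ℝ}

lemma qf_lagrangian (A₀ A₁ A₂ : Matrix (Fin n) (Fin n) ℝ) (a b c : ℝ) (x : Fin n → ℝ) :
    qf (A₀ + a • A₁ + b • A₂ + c • 1) x = qf A₀ x + a * qf A₁ x + b * qf A₂ x + c * qf 1 x := by
  simp only [qf_add_matrix, qf_smul_matrix]

lemma isSymm_lagrangian (h₀ : A₀.IsSymm) (h₁ : A₁.IsSymm) (h₂ : A₂.IsSymm) (a b c : ℝ) :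
    (A₀ + a • A₁ + b • A₂ + c • (1 : Matrix (Fin n) (Fin n) ℝ)).IsSymm :=
  ((h₀.add (h₁.smul a)).add (h₂.smul b)).add (Matrix.isSymm_one.smul c)

/-- The dual problem, minimizing the shift `c` that makes the Lagrangian positive semidefinite,
attains its optimum: a Slater point bounds the multipliers. -/
lemma exists_minimal_shift (hx : ∃ x, qf A₁ x < 0 ∧ qf A₂ x < 0) :
    ∃ a b c : ℝ, 0 ≤ a ∧ 0 ≤ b ∧ 0 ≤ c ∧ (∀ x, 0 ≤ qf (A₀ + a • A₁ + b • A₂ + c • 1) x) ∧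
      ∀ a' b' c' : ℝ, 0 ≤ a' → 0 ≤ b' → 0 ≤ c' →
        (∀ x, 0 ≤ qf (A₀ + a' • A₁ + b' • A₂ + c' • 1) x) → c ≤ c' := by
  obtain ⟨x₀, hx1, hx2⟩ := hx
  obtain ⟨M, hM, hMA⟩ := exists_le_mul_qf_one A₀
  obtain ⟨K, hK⟩ : ∃ K, K = {p : ℝ × ℝ × ℝ | ∀ x, 0 ≤ qf A₀ x + p.1 * qf A₁ x + p.2.1 * qf A₂ x
      + p.2.2 * qf 1 x} ∩ {p | 0 ≤ p.1 ∧ 0 ≤ p.2.1 ∧ 0 ≤ p.2.2 ∧ p.2.2 ≤ M} := ⟨_, rfl⟩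
  have hclosed : IsClosed K := by
    rw [hK]
    simp only [Set.ofPred_and, Set.ofPred_forall]
    refine (isClosed_iInter fun x => isClosed_le (by fun_prop) (by fun_prop)).inter ?_
    refine IsClosed.inter ?_ (IsClosed.inter ?_ (IsClosed.inter ?_ ?_)) <;>
      exact isClosed_le (by fun_prop) (by fun_prop)
  have hcompact : IsCompact K := by
    refine (isCompact_Icc (a := ((0 : ℝ), (0 : ℝ), (0 : ℝ)))
      (b := ((qf A₀ x₀ + M * qf 1 x₀) / -qf A₁ x₀, (qf A₀ x₀ + M * qf 1 x₀) / -qf A₂ x₀, M))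
      ).of_isClosed_subset hclosed ?_
    rw [hK]
    rintro ⟨a, b, c⟩ ⟨h, ha, hb, hc, hcM⟩
    have h0 := h x₀
    simp only at h0 ha hb hc hcM
    have h3 : c * qf 1 x₀ ≤ M * qf 1 x₀ := mul_le_mul_of_nonneg_right hcM (qf_one_nonneg x₀)
    have h1 : a * qf A₁ x₀ ≤ 0 := mul_nonpos_of_nonneg_of_nonpos ha hx1.le
    have h2 : b * qf A₂ x₀ ≤ 0 := mul_nonpos_of_nonneg_of_nonpos hb hx2.le
    refine ⟨⟨ha, hb, hc⟩, ?_, ?_, hcM⟩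
    · change a ≤ _
      rw [le_div_iff₀ (by linarith)]
      linarith
    · change b ≤ _
      rw [le_div_iff₀ (by linarith)]
      linarith
  have hne : K.Nonempty := by
    rw [hK]
    refine ⟨(0, 0, M), fun x => ?_, le_rfl, le_rfl, hM.le, le_rfl⟩
    simp only [zero_mul, add_zero]
    linarith [hMA x]
  obtain ⟨⟨a, b, c⟩, hmem, hmin⟩ := hcompact.exists_isMinOn hne
    (f := fun p : ℝ × ℝ × ℝ => p.2.2) (by fun_prop)
  have hmem' := hmem
  rw [hK] at hmem'
  obtain ⟨h, ha, hb, hc, hcM⟩ := hmem'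
  refine ⟨a, b, c, ha, hb, hc, fun x => ?_, fun a' b' c' ha' hb' hc' h' => ?_⟩
  · rw [qf_lagrangian]
    exact h x
  · rcases le_total c' M with hcM' | hcM'
    · refine hmin (a := (a', b', c')) ?_
      rw [hK]
      exact ⟨fun x => qf_lagrangian A₀ A₁ A₂ a' b' c' x ▸ h' x, ha', hb', hc', hcM'⟩
    · exact le_trans hcM hcM'

/-- A theorem of the alternative on a subspace `N`. The cone `P` is cut out of the nonpositive
quadrant by complementarity with the signs of `a` and `b`; it either meets the convex hull of the
joint range of the two forms over unit vectors, or is strictly separated from it by a combination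
of the forms which is positive definite on `N`. In the convex hull every point is a sum of two
values, by Dines' theorem. -/
lemma exists_pair_or_pos_combination (A₁ A₂ : Matrix (Fin n) (Fin n) ℝ)
    (N : Submodule ℝ (Fin n → ℝ)) (a b : ℝ) :
    (∃ x ∈ N, ∃ y ∈ N, x ≠ 0 ∧
      qf A₁ x + qf A₁ y ≤ 0 ∧ qf A₂ x + qf A₂ y ≤ 0 ∧
      (a ≠ 0 → qf A₁ x + qf A₁ y = 0) ∧ (b ≠ 0 → qf A₂ x + qf A₂ y = 0)) ∨
    ∃ d e : ℝ, (a = 0 → 0 ≤ d) ∧ (b = 0 → 0 ≤ e) ∧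
      ∀ x ∈ N, x ≠ 0 → 0 < d * qf A₁ x + e * qf A₂ x := by
  obtain ⟨S, hS⟩ : ∃ S : Set (ℝ × ℝ), S = (fun x => (qf A₁ x, qf A₂ x)) ''
      ({x | qf 1 x = 1} ∩ (N : Set (Fin n → ℝ))) := ⟨_, rfl⟩
  obtain ⟨P, hP⟩ : ∃ P : Set (ℝ × ℝ), P = {p | p.1 ≤ 0 ∧ p.2 ≤ 0 ∧ (a ≠ 0 → p.1 = 0) ∧
      (b ≠ 0 → p.2 = 0)} := ⟨_, rfl⟩
  have hScompact : IsCompact S := by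
    rw [hS]
    exact (isCompact_setOf_qf_one_eq_one.inter_right N.closed_of_finiteDimensional).image
      ((continuous_qf A₁).prodMk (continuous_qf A₂))
  have hPconvex : Convex ℝ P := by
    rw [hP]
    rintro ⟨p1, p2⟩ ⟨hp1, hp2, hpa, hpb⟩ ⟨q1, q2⟩ ⟨hq1, hq2, hqa, hqb⟩ s t hs ht -
    simp only at hp1 hp2 hpa hpb hq1 hq2 hqa hqb
    refine ⟨?_, ?_, fun h => ?_, fun h => ?_⟩
    · change s * p1 + t * q1 ≤ 0
      linarith [mul_nonpos_of_nonneg_of_nonpos hs hp1, mul_nonpos_of_nonneg_of_nonpos ht hq1]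
    · change s * p2 + t * q2 ≤ 0
      linarith [mul_nonpos_of_nonneg_of_nonpos hs hp2, mul_nonpos_of_nonneg_of_nonpos ht hq2]
    · change s * p1 + t * q1 = 0
      rw [hpa h, hqa h, mul_zero, mul_zero, add_zero]
    · change s * p2 + t * q2 = 0
      rw [hpb h, hqb h, mul_zero, mul_zero, add_zero]
  have hPclosed : IsClosed P := by
    rw [hP]
    simp only [Set.ofPred_and, Set.ofPred_forall]
    refine IsClosed.inter (isClosed_le (by fun_prop) (by fun_prop))
      (IsClosed.inter (isClosed_le (by fun_prop) (by fun_prop))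
        (IsClosed.inter ?_ ?_)) <;>
      exact isClosed_iInter fun _ => isClosed_eq (by fun_prop) (by fun_prop)
  by_cases hdisj : Disjoint (convexHull ℝ S) P
  · right
    obtain ⟨f, u, v, hfu, huv, hfv⟩ := geometric_hahn_banach_compact_closed
      (convex_convexHull ℝ S) hScompact.convexHull_of_finiteDimensional hPconvex hPclosed hdisj
    have hv0 : v < 0 := by
      have := hfv 0 (by rw [hP]; exact ⟨le_rfl, le_rfl, fun _ => rfl, fun _ => rfl⟩)
      rwa [map_zero] at this
    have hf : ∀ p : ℝ × ℝ, f p = p.1 * f (1, 0) + p.2 * f (0, 1) := by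
      intro p
      rw [← smul_eq_mul, ← smul_eq_mul, ← map_smul, ← map_smul, ← map_add]
      simp
    -- `f` is bounded below on the cone `P`, hence nonnegative there.
    have hcone : ∀ p : ℝ × ℝ, (∀ r : ℝ, 0 ≤ r → r • p ∈ P) → 0 ≤ f p := by
      intro p hp
      by_contra! h
      have := hfv _ (hp (v / f p) (div_nonneg_of_nonpos hv0.le h.le))
      rw [map_smul, smul_eq_mul, div_mul_cancel₀ _ h.ne] at this
      exact this.false
    refine ⟨-f (1, 0), -f (0, 1), fun ha => ?_, fun hb => ?_, fun x hx hx0 => ?_⟩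
    · have := hcone (-1, 0) fun r hr => by rw [hP]; simp [ha, hr]
      rw [hf] at this
      linarith
    · have := hcone (0, -1) fun r hr => by rw [hP]; simp [hb, hr]
      rw [hf] at this
      linarith
    · obtain ⟨r, hr, hr1⟩ := exists_smul_qf_one_eq_one hx0
      have := hfu (qf A₁ (r • x), qf A₂ (r • x)) (subset_convexHull ℝ S (by
        rw [hS]
        exact ⟨r • x, ⟨hr1, N.smul_mem r hx⟩, rfl⟩))
      rw [hf, qf_smul, qf_smul] at this
      simp only at this
      have hr2 : 0 < r ^ 2 := by positivity
      refine pos_of_mul_pos_right (a := r ^ 2) ?_ hr2.le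
      linarith
  · left
    obtain ⟨p, hpS, hpP⟩ := Set.not_disjoint_iff.1 hdisj
    have hG : convexHull ℝ S ⊆ {p | ∃ x ∈ N, ∃ y ∈ N, x ≠ 0 ∧
        p = (qf A₁ x + qf A₁ y, qf A₂ x + qf A₂ y)} := by
      refine convexHull_min ?_ ?_
      · rw [hS]
        rintro _ ⟨x, ⟨hx1, hx⟩, rfl⟩
        refine ⟨x, hx, 0, N.zero_mem, ?_, by simp only [qf_zero, add_zero]⟩
        rintro rfl
        rw [Set.mem_ofPred_eq, qf_zero] at hx1
        exact zero_ne_one hx1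
      · rintro _ ⟨x, hx, y, hy, hx0, rfl⟩ _ ⟨x', hx', y', hy', hx0', rfl⟩ s t hs ht hst
        have hscale : ∀ (r : ℝ) (B : Matrix (Fin n) (Fin n) ℝ) (z : Fin n → ℝ), 0 ≤ r →
            qf B (Real.sqrt r • z) = r * qf B z := fun r B z hr => by
          rw [qf_smul, Real.sq_sqrt hr]
        rcases hs.eq_or_lt with rfl | hs'
        · obtain rfl : t = 1 := by linarith
          exact ⟨x', hx', y', hy', hx0', by simp⟩
        obtain ⟨z₁, hz₁, h11, h12⟩ := exists_qf_eq_add' (A₁ := A₁) (A₂ := A₂)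
          (N.smul_mem (Real.sqrt t) hx') (N.smul_mem (Real.sqrt t) hy')
        obtain ⟨z₂, hz₂, h21, h22⟩ := exists_qf_eq_add' (A₁ := A₁) (A₂ := A₂)
          (N.smul_mem (Real.sqrt s) hy) hz₁
        refine ⟨Real.sqrt s • x, N.smul_mem _ hx, z₂, hz₂,
          smul_ne_zero (Real.sqrt_pos.2 hs').ne' hx0, ?_⟩
        rw [h21, h22, h11, h12]
        simp only [hscale _ _ _ hs, hscale _ _ _ ht, Prod.smul_mk, Prod.mk_add_mk, smul_eq_mul]
        rw [Prod.mk.injEq]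
        constructor <;> ring
    obtain ⟨x, hx, y, hy, hx0, rfl⟩ := hG hpS
    rw [hP] at hpP
    exact ⟨x, hx, y, hy, hx0, hpP⟩

/-- At a positive minimal shift no combination of the constraint forms, with signs admissible for
the multipliers, is positive definite on the null space of the Lagrangian: it would allow the shift
to be decreased. -/
lemma not_pos_combination_of_minimal {a b c : ℝ} (ha : 0 ≤ a) (hb : 0 ≤ b) (hc : 0 < c)
    (hZ : (A₀ + a • A₁ + b • A₂ + c • (1 : Matrix (Fin n) (Fin n) ℝ)).PosSemidef)
    (hmin : ∀ a' b' c' : ℝ, 0 ≤ a' → 0 ≤ b' → 0 ≤ c' →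
        (∀ x, 0 ≤ qf (A₀ + a' • A₁ + b' • A₂ + c' • 1) x) → c ≤ c')
    {d e : ℝ} (hd : a = 0 → 0 ≤ d) (he : b = 0 → 0 ≤ e) :
    ¬ ∀ x, (A₀ + a • A₁ + b • A₂ + c • (1 : Matrix (Fin n) (Fin n) ℝ)) *ᵥ x = 0 → x ≠ 0 →
      0 < d * qf A₁ x + e * qf A₂ x := by
  intro hpos
  obtain ⟨ε₀, hε₀, h⟩ := exists_perturbation_pos (D := d • A₁ + e • A₂) hZ fun x hx hx0 => by
    simpa only [qf_add_matrix, qf_smul_matrix] using hpos x hx hx0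
  have hsmall : ∀ {p q : ℝ}, 0 ≤ p → (p = 0 → 0 ≤ q) →
      ∃ ε₁ : ℝ, 0 < ε₁ ∧ ∀ ε, 0 < ε → ε < ε₁ → 0 ≤ p + ε * q := by
    intro p q hp hq
    rcases hp.eq_or_lt with h0 | h0
    · exact ⟨1, one_pos, fun ε hε _ => by rw [← h0, zero_add]; exact mul_nonneg hε.le (hq h0.symm)⟩
    · refine ⟨p / (|q| + 1), by positivity, fun ε hε hε1 => ?_⟩
      rw [lt_div_iff₀ (by positivity)] at hε1
      nlinarith [mul_le_mul_of_nonneg_left (neg_abs_le q) hε.le]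
  obtain ⟨ε₁, hε₁, h1⟩ := hsmall ha hd
  obtain ⟨ε₂, hε₂, h2⟩ := hsmall hb he
  obtain ⟨ε, hε, hlt⟩ := exists_between (lt_min hε₀ (lt_min hε₁ hε₂))
  rw [lt_min_iff, lt_min_iff] at hlt
  obtain ⟨δ, hδ, hle⟩ := h ε hε hlt.1
  have hmin' := hmin (a + ε * d) (b + ε * e) (c - min δ c) (h1 ε hε hlt.2.1) (h2 ε hε hlt.2.2)
    (by linarith [min_le_right δ c]) fun x => by
      have := hle x
      rw [qf_add_matrix, qf_smul_matrix, qf_lagrangian, qf_add_matrix, qf_smul_matrix,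
        qf_smul_matrix] at this
      rw [qf_lagrangian]
      linarith [mul_le_mul_of_nonneg_right (min_le_left δ c) (qf_one_nonneg x)]
  linarith [lt_min hδ hc]

/-- A nonzero vector in the null space of the Lagrangian that is feasible and complementary to the
multipliers makes the objective form negative. -/
lemma qf_neg_of_complementary {a b c : ℝ} (hc : 0 < c) {z : Fin n → ℝ}
    (hz : (A₀ + a • A₁ + b • A₂ + c • (1 : Matrix (Fin n) (Fin n) ℝ)) *ᵥ z = 0) (hz0 : z ≠ 0)
    (h1 : a * qf A₁ z = 0) (h2 : b * qf A₂ z = 0) : qf A₀ z < 0 := by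
  have h : qf (A₀ + a • A₁ + b • A₂ + c • 1) z = 0 := by
    rw [qf, hz, dotProduct_zero]
  rw [qf_lagrangian, h1, h2] at h
  linarith [mul_pos hc (qf_one_pos hz0)]

/-- At a positive minimal shift either the quadratic system is solvable or `PropertyIR` holds. -/
lemma exists_solution_or_propertyIR (h₀ : A₀.IsSymm) (h₁ : A₁.IsSymm) (h₂ : A₂.IsSymm)
    {a b c : ℝ} (ha : 0 ≤ a) (hb : 0 ≤ b) (hc : 0 < c)
    (hZ : ∀ x, 0 ≤ qf (A₀ + a • A₁ + b • A₂ + c • 1) x)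
    (hmin : ∀ a' b' c' : ℝ, 0 ≤ a' → 0 ≤ b' → 0 ≤ c' →
        (∀ x, 0 ≤ qf (A₀ + a' • A₁ + b' • A₂ + c' • 1) x) → c ≤ c') :
    (∃ x, qf A₀ x < 0 ∧ qf A₁ x ≤ 0 ∧ qf A₂ x ≤ 0) ∨ PropertyIR A₀ A₁ A₂ := by
  have hZ' := (posSemidef_iff_qf_nonneg (isSymm_lagrangian h₀ h₁ h₂ a b c)).2 hZ
  obtain ⟨N, hN⟩ : ∃ N, N = LinearMap.ker
      (A₀ + a • A₁ + b • A₂ + c • (1 : Matrix (Fin n) (Fin n) ℝ)).mulVecLin := ⟨_, rfl⟩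
  have hmem : ∀ x, x ∈ N ↔ (A₀ + a • A₁ + b • A₂ + c • (1 : Matrix (Fin n) (Fin n) ℝ)) *ᵥ x = 0 :=
    fun x => by rw [hN, LinearMap.mem_ker, Matrix.mulVecLin_apply]
  have hsol : ∀ z ∈ N, z ≠ 0 → qf A₁ z ≤ 0 → qf A₂ z ≤ 0 → a * qf A₁ z = 0 → b * qf A₂ z = 0 →
      ∃ x, qf A₀ x < 0 ∧ qf A₁ x ≤ 0 ∧ qf A₂ x ≤ 0 := fun z hz hz0 h1 h2 ha hb =>
    ⟨z, qf_neg_of_complementary hc ((hmem z).1 hz) hz0 ha hb, h1, h2⟩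
  rcases exists_pair_or_pos_combination A₁ A₂ N a b with
    ⟨x, hx, y, hy, hx0, h1, h2, h1a, h2b⟩ | ⟨d, e, hd, he, hpos⟩
  swap
  · exact absurd (fun x hx => hpos x ((hmem x).2 hx))
      (not_pos_combination_of_minimal ha hb hc hZ' hmin hd he)
  by_cases hne : qf A₁ x + qf A₁ y ≠ 0 ∨ qf A₂ x + qf A₂ y ≠ 0
  · obtain ⟨z, hz, hz0, hz1, hz2⟩ := exists_qf_eq_add hx hy hne
    refine Or.inl (hsol z hz hz0 (hz1 ▸ h1) (hz2 ▸ h2) ?_ ?_)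
    · by_cases h : a = 0
      · rw [h, zero_mul]
      · rw [hz1, h1a h, mul_zero]
    · by_cases h : b = 0
      · rw [h, zero_mul]
      · rw [hz2, h2b h, mul_zero]
  · push Not at hne
    rcases hb.eq_or_lt with hb0 | hb0
    · obtain ⟨z, hz, hz0, hz1, hz2⟩ := exists_isotropic_nonpos hx hy hx0 hne.1 hne.2
      exact Or.inl (hsol z hz hz0 hz1.le hz2 (by rw [hz1, mul_zero]) (by rw [← hb0, zero_mul]))
    rcases ha.eq_or_lt with ha0 | ha0
    · obtain ⟨z, hz, hz0, hz2, hz1⟩ := exists_isotropic_nonpos hx hy hx0 hne.2 hne.1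
      exact Or.inl (hsol z hz hz0 hz1 hz2.le (by rw [← ha0, zero_mul]) (by rw [hz2, mul_zero]))
    rcases exists_common_zero_or_hyperbolic_plane h₁ hx hy hx0 hne.1 hne.2 with
      ⟨z, hz, hz0, hz1, hz2⟩ | ⟨u, v, hspan, hu1, hv1, huv, hu2, hv2⟩
    · exact Or.inl (hsol z hz hz0 hz1.le hz2.le (by rw [hz1, mul_zero]) (by rw [hz2, mul_zero]))
    · exact Or.inr ⟨a, b, c, u, v, ha0, hb0, hc, hZ', hspan.trans hN, hu1, hv1, huv, hu2, hv2⟩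

/-- A positive semidefinite `A₀ + a A₁ + b A₂` exceeds the matrix `Z` of `PropertyIR` on the null
space of `Z` by a positive definite form; at the two `A₁`-isotropic vectors this forces opposite
signs of `b - μ₂`. -/
lemma not_propertyIR_of_nonneg {a b : ℝ}
    (h : ∀ x, 0 ≤ qf A₀ x + a * qf A₁ x + b * qf A₂ x) : ¬ PropertyIR A₀ A₁ A₂ := by
  rintro ⟨μ₁, μ₂, μ₃, u, v, -, -, hμ₃, -, hspan, hu1, hv1, -, hu2, hv2⟩
  have key : ∀ z ∈ Submodule.span ℝ {u, v}, z ≠ 0 → qf A₁ z = 0 →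
      0 < (b - μ₂) * qf A₂ z := by
    intro z hz hz0 hz1
    rw [hspan, LinearMap.mem_ker, Matrix.mulVecLin_apply] at hz
    have hZ : qf (A₀ + μ₁ • A₁ + μ₂ • A₂ + μ₃ • 1) z = 0 := by rw [qf, hz, dotProduct_zero]
    rw [qf_lagrangian] at hZ
    have := h z
    rw [hz1] at this hZ
    linarith [mul_pos hμ₃ (qf_one_pos hz0)]
  have hu := key u (Submodule.subset_span (by simp)) (by rintro rfl; simp at hu2) hu1
  have hv := key v (Submodule.subset_span (by simp)) (by rintro rfl; simp at hv2) hv1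
  have hb : 0 < b - μ₂ := pos_of_mul_pos_left hv hv2.le
  exact (mul_neg_of_pos_of_neg hb hu2).not_gt hu

end Duality

theorem mainTheorem3 (n : ℕ) (A₀ A₁ A₂ : Matrix (Fin n) (Fin n) ℝ)
    (h₀ : A₀.IsSymm) (h₁ : A₁.IsSymm) (h₂ : A₂.IsSymm)
    (hx : ∃ x₀ : Fin n → ℝ, x₀ ⬝ᵥ A₁ *ᵥ x₀ < 0 ∧ x₀ ⬝ᵥ A₂ *ᵥ x₀ < 0) :
    ((¬ ∃ x : Fin n → ℝ,
        x ⬝ᵥ A₀ *ᵥ x < 0 ∧ x ⬝ᵥ A₁ *ᵥ x ≤ 0 ∧ x ⬝ᵥ A₂ *ᵥ x ≤ 0) ∧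
      ¬ PropertyIR A₀ A₁ A₂) ↔
    ∃ μ₁ μ₂ : ℝ, 0 ≤ μ₁ ∧ 0 ≤ μ₂ ∧ (A₀ + μ₁ • A₁ + μ₂ • A₂).PosSemidef := by
  constructor
  · rintro ⟨hno, hIR⟩
    obtain ⟨a, b, c, ha, hb, hc, hZ, hmin⟩ := exists_minimal_shift (A₀ := A₀) hx
    rcases hc.eq_or_lt with rfl | hc
    · refine ⟨a, b, ha, hb, (posSemidef_iff_qf_nonneg ((h₀.add (h₁.smul a)).add (h₂.smul b))).2 ?_⟩
      simpa using hZ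
    · exact ((exists_solution_or_propertyIR h₀ h₁ h₂ ha hb hc hZ hmin).elim hno hIR).elim
  · rintro ⟨a, b, ha, hb, hpsd⟩
    have h : ∀ x, 0 ≤ qf A₀ x + a * qf A₁ x + b * qf A₂ x := fun x => by
      simpa only [qf_add_matrix, qf_smul_matrix] using
        (posSemidef_iff_qf_nonneg ((h₀.add (h₁.smul a)).add (h₂.smul b))).1 hpsd x
    refine ⟨?_, not_propertyIR_of_nonneg h⟩
    rintro ⟨x, hx0, hx1, hx2⟩
    have h1 : a * qf A₁ x ≤ 0 := mul_nonpos_of_nonneg_of_nonpos ha hx1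
    have h2 : b * qf A₂ x ≤ 0 := mul_nonpos_of_nonneg_of_nonpos hb hx2
    have h0 : qf A₀ x < 0 := hx0
    linarith [h x]
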